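/- Theorem (Existence of a scene). Let $k \ge 0$ be an integer and let $\mathcal C$ be a standard Borel space (the configurations of the sensors). Let $\mathbf y_i = (y_i, c_i)$, $i \in I$, be a finite or countably infinite family of random variables (the measurements) on a probability space, with values in $E = \mathbb R^k \times \mathcal C$. For distinct indices $i_1, \dots, i_n \in I$ write $p(\mathbf y_{i_1}, \dots, \mathbf y_{i_n})$ for the joint law, a probability measure on $E^n$. Suppose that 1. the measurements are exchangeable: $p(\mathbf y_{i_1}, \dots, \mathbf y_{i_n}) = p(\mathbf y_{i_{\pi(1)}}, \dots, \mathbf y_{i_{\pi(n)}})$ for every $n$, all distinct $i_1, \dots, i_n \in I$ and every permutation $\pi$ of $\{1, \dots, n\}$; 2. each finite sequence of measurements extends to an infinite exchangeable sequence: for every $n$ and all distinct $i_1, \dots, i_n \in I$ there is an infinite exchangeable sequence of $E$-valued random variables (on some probability space) whose first $n$ terms have the joint law $p(\mathbf y_{i_1}, \dots, \mathbf y_{i_n})$. Then a scene exists. That is, there are a measurable space $\mathbb S$, a Markov kernel $s \mapsto p(\cdot \mid s)$ from $\mathbb S$ to $E$, a probability space carrying a family $(\mathbf y'_i)_{i \in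 I}$ with the same joint law as $(\mathbf y_i)_{i \in I}$, and on that probability space an $\mathbb S$-valued random variable $S$, with law $P(S)$, such that, conditionally on $S$, the $\mathbf y'_i$ are independent and each has law $p(\cdot \mid S)$. In particular, with this one $S$, for every $n$, all distinct $i_1, \dots, i_n \in I$ and every measurable $B \subseteq E^n$, $$p(\mathbf y_{i_1}, \dots, \mathbf y_{i_n})(B) = \int_{\mathbb S} \bigl(p(\cdot \mid s) \otimes \cdots \otimes p(\cdot \mid s)\bigr)(B)\, dP(s).$$ -/

import Mathlib

open MeasureTheory ProbabilityTheory

universe u v w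

/-- A measurement is a pair `(y, c)`: the readings `y ∈ ℝᵏ` of `k` sensors, and the
configuration `c ∈ C` of the sensors. -/
abbrev Measurement (k : ℕ) (C : Type*) : Type _ := EuclideanSpace ℝ (Fin k) × C

section Scenes

variable {Ω ι E 𝕊 : Type*} [MeasurableSpace Ω] [MeasurableSpace E] [MeasurableSpace 𝕊]

/-- The joint law `p(Y (e 0), …, Y (e (n - 1)))` of the measurements with the indices listed
by `e`. -/
noncomputable def jointLaw (P : Measure Ω) (Y : ι → Ω → E) {n : ℕ} (e : Fin n → ι) :
    Measure (Fin n → E) :=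
  P.map (fun ω i => Y (e i) ω)

/-- The family `Y` is exchangeable: the joint law of any finitely many of its members does not
change when they are permuted. For `ι = Fin n` this is exchangeability of a finite sequence and
for `ι = ℕ` exchangeability of an infinite sequence. -/
def Exchangeable (P : Measure Ω) (Y : ι → Ω → E) : Prop :=
  ∀ (n : ℕ) (e : Fin n ↪ ι) (π : Equiv.Perm (Fin n)),
    jointLaw P Y (fun i => e (π i)) = jointLaw P Y e

/-- A law `p` of `n` measurements extends to an infinite exchangeable sequence: it is the law of
the first `n` terms of such a sequence. The infinite sequence is given by its law `ρ` on the space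
of sequences, as the sequence of coordinates. -/
def ExtendsToExchangeable {n : ℕ} (p : Measure (Fin n → E)) : Prop :=
  ∃ ρ : Measure (ℕ → E), IsProbabilityMeasure ρ ∧
    Exchangeable ρ (fun (j : ℕ) (z : ℕ → E) => z j) ∧
    jointLaw ρ (fun (j : ℕ) (z : ℕ → E) => z j) (fun i : Fin n => (i : ℕ)) = p

/-- The random variable `S` is a scene for the measurements `Y`, with presentation
`κ = p(· | S)`: given `S`, the measurements are independent and each has law `κ S`. In other words,
for any finitely many distinct indices `e 0, …, e (n - 1)`, the conditional law given `S = s` of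
the measurements with these indices is the `n`-fold product `p(· | s) ⊗ ⋯ ⊗ p(· | s)`. -/
structure IsScene (P : Measure Ω) (Y : ι → Ω → E) (S : Ω → 𝕊) (κ : Kernel 𝕊 E) : Prop where
  measurable : Measurable S
  indep : ∀ (n : ℕ) (e : Fin n ↪ ι) (A : Set (𝕊 × (Fin n → E))), MeasurableSet A →
    P.map (fun ω => (S ω, fun i => Y (e i) ω)) A =
      ∫⁻ s, Measure.pi (fun _ : Fin n => κ s) {y | (s, y) ∈ A} ∂(P.map S)

end Scenes

open scoped ENNReal

section DeFinetti

variable {Ω E F : Type*} [MeasurableSpace Ω] [MeasurableSpace E] [MeasurableSpace F]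

/-! This is de Finetti's theorem. The family embeds in an exchangeable sequence `z`, whose law is
invariant under every injective reindexing. The odd coordinates serve as the scene and the even ones
as the measurements; `κ` is the conditional law of `z 0` given its tail. Let `W` be the odd
coordinates and `W'` the same list preceded by finitely many even ones. By invariance a further even
coordinate has conditional law `κ W` given `W` and `κ W'` given `W'`. So, for each event, `κ W` is
the conditional expectation of `κ W'` given `W`, with the same second moment, and the two agree
almost surely (`condKernel_ae_eq_of_law_eq`). The extra even coordinates thus carry no further
information, and induction on their number gives the product formula (`setLIntegral_even_eq`). -/

/-- An exchangeable probability law on sequences is invariant under every injective reindexing. -/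
theorem Exchangeable.map_comp_injective {ρ : Measure (ℕ → E)} [IsProbabilityMeasure ρ]
    (h : Exchangeable ρ (fun (j : ℕ) (z : ℕ → E) => z j)) {σ : ℕ → ℕ}
    (hσ : Function.Injective σ) :
    ρ.map (fun z j => z (σ j)) = ρ := by
  have hm : Measurable (fun (z : ℕ → E) (j : ℕ) => z (σ j)) := by fun_prop
  refine IsProjectiveLimit.unique (P := fun I : Finset ℕ => ρ.map I.restrict) ?_ (fun I => rfl)
  intro I
  rw [Measure.map_map (Finset.measurable_restrict I) hm]
  obtain ⟨N, hN⟩ : ∃ N, ∀ i ∈ I, i < N ∧ σ i < N := by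
    refine ⟨I.sup id + I.sup σ + 1, fun i hi => ?_⟩
    have h1 : i ≤ I.sup id := Finset.le_sup (f := id) hi
    have h2 : σ i ≤ I.sup σ := Finset.le_sup (f := σ) hi
    omega
  -- On a finite set of coordinates, `σ` agrees with a permutation of a large enough `Fin N`.
  obtain ⟨π, hπ⟩ := Equiv.Perm.exists_extending_pair
    (fun i : I => (⟨i, (hN i i.2).1⟩ : Fin N)) (fun i : I => (⟨σ i, (hN i i.2).2⟩ : Fin N))
    (fun a b hab => Subtype.ext (by simpa using hab))
    (fun a b hab => Subtype.ext (hσ (by simpa using hab)))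
  have key := congrArg (Measure.map (fun (x : Fin N → E) (i : I) => x ⟨i, (hN i i.2).1⟩))
    (h N Fin.valEmbedding π)
  rw [jointLaw, jointLaw, Measure.map_map (by fun_prop) (by fun_prop),
    Measure.map_map (by fun_prop) (by fun_prop)] at key
  refine Eq.trans ?_ (key.trans rfl)
  congr 1
  ext z i
  simp [hπ i]

/-- If two conditioning variables `W'` and `W = g ∘ W'` have the same law and `κ` is the conditional
law of `X` given either of them, then `κ W` and `κ W'` agree almost surely on each event. -/
theorem condKernel_ae_eq_of_law_eq {μ : Measure Ω} [IsProbabilityMeasure μ] {X : Ω → E}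
    {W W' : Ω → F} {g : F → F} (hW' : Measurable W') (hg : Measurable g)
    (hWg : ∀ ω, W ω = g (W' ω)) (hlaw : μ.map W = μ.map W')
    {κ : Kernel F E} [IsMarkovKernel κ] {B : Set E} (hB : MeasurableSet B)
    (h : ∀ f : F → ℝ≥0∞, Measurable f →
      ∫⁻ ω in X ⁻¹' B, f (W ω) ∂μ = ∫⁻ ω, f (W ω) * κ (W ω) B ∂μ)
    (h' : ∀ f : F → ℝ≥0∞, Measurable f →
      ∫⁻ ω in X ⁻¹' B, f (W' ω) ∂μ = ∫⁻ ω, f (W' ω) * κ (W' ω) B ∂μ) :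
    ∀ᵐ ω ∂μ, κ (W ω) B = κ (W' ω) B := by
  have hκ : Measurable fun w => κ w B := κ.measurable_coe hB
  have hW : Measurable W := by
    rw [show W = g ∘ W' from funext hWg]; exact hg.comp hW'
  -- Both sides equal the integral of `κ (W ω) B` over `X ⁻¹' B`, since `W` is a function of `W'`.
  have hab : ∫⁻ ω, κ (W ω) B * κ (W' ω) B ∂μ = ∫⁻ ω, κ (W ω) B * κ (W ω) B ∂μ := by
    rw [← h _ hκ]
    simp_rw [hWg]
    exact (h' (fun w => κ (g w) B) (hκ.comp hg)).symm
  have hbb : ∫⁻ ω, κ (W' ω) B * κ (W' ω) B ∂μ = ∫⁻ ω, κ (W ω) B * κ (W ω) B ∂μ := by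
    rw [← lintegral_map (f := fun w => κ w B * κ w B) (by fun_prop) hW', ← hlaw,
      lintegral_map (by fun_prop) hW]
  have hle : ∀ a b : ℝ≥0∞, a ≤ 1 → b ≤ 1 → 2 * (a * b) ≤ a * a + b * b ∧
      (2 * (a * b) = a * a + b * b → a = b) := by
    intro a b ha hb
    lift a to NNReal using ne_top_of_le_ne_top ENNReal.one_ne_top ha
    lift b to NNReal using ne_top_of_le_ne_top ENNReal.one_ne_top hb
    norm_cast
    rw [← NNReal.coe_le_coe, ← NNReal.coe_inj, ← NNReal.coe_inj]
    push_cast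
    refine ⟨by nlinarith [sq_nonneg ((a : ℝ) - b)], fun hab => ?_⟩
    have : ((a : ℝ) - b) ^ 2 = 0 := by linarith
    exact sub_eq_zero.1 (pow_eq_zero_iff two_ne_zero |>.1 this)
  have hmW : Measurable fun ω => κ (W ω) B := hκ.comp hW
  have hmW' : Measurable fun ω => κ (W' ω) B := hκ.comp hW'
  -- This replaces a vanishing integral of `(a - b) ^ 2`, as subtraction in `ℝ≥0∞` truncates.
  have hint : ∫⁻ ω, (κ (W ω) B * κ (W ω) B + κ (W' ω) B * κ (W' ω) B) ∂μ
      = ∫⁻ ω, 2 * (κ (W ω) B * κ (W' ω) B) ∂μ := by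
    rw [lintegral_add_left (by fun_prop), lintegral_const_mul _ (by fun_prop), hab, hbb, two_mul]
  have hfin : ∫⁻ ω, 2 * (κ (W ω) B * κ (W' ω) B) ∂μ ≠ ∞ := by
    refine ne_top_of_le_ne_top (b := 2) (by simp) ?_
    calc _ ≤ ∫⁻ _, 2 ∂μ := lintegral_mono fun ω => by
            have : κ (W ω) B * κ (W' ω) B ≤ 1 := mul_le_one' prob_le_one prob_le_one
            simpa using mul_le_mul_right this 2
      _ = 2 := by simp
  filter_upwards [ae_eq_of_ae_le_of_lintegral_le
    (ae_of_all _ fun ω => (hle _ _ prob_le_one prob_le_one).1) hfin (by fun_prop) hint.le] with ω hω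
  exact (hle _ _ prob_le_one prob_le_one).2 hω

/-- The `n`-fold product of a Markov kernel with itself. -/
noncomputable def powKernel (κ : Kernel F E) [IsMarkovKernel κ] (n : ℕ) :
    Kernel F (Fin n → E) where
  toFun s := Measure.pi fun _ => κ s
  measurable' := by
    refine Measurable.measure_of_isPiSystem_of_isProbabilityMeasure generateFrom_pi.symm
      isPiSystem_pi ?_
    rintro _ ⟨B, hB, rfl⟩
    simp only [Measure.pi_pi]
    exact Finset.measurable_prod _ fun i _ => κ.measurable_coe (hB i (Set.mem_univ i))

theorem powKernel_apply (κ : Kernel F E) [IsMarkovKernel κ] (n : ℕ) (s : F) :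
    powKernel κ n s = Measure.pi fun _ => κ s := rfl

instance (κ : Kernel F E) [IsMarkovKernel κ] (n : ℕ) : IsMarkovKernel (powKernel κ n) :=
  ⟨fun s => by rw [powKernel_apply]; infer_instance⟩

/-- A joint law that has the right value on boxes is the composition of the marginal with the
`n`-fold product kernel. -/
theorem map_prodMk_eq_compProd_powKernel {μ : Measure Ω} [IsProbabilityMeasure μ] {W : Ω → F}
    (hW : Measurable W) {n : ℕ} {Z : Ω → Fin n → E} (hZ : Measurable Z) (κ : Kernel F E)
    [IsMarkovKernel κ]
    (h : ∀ (T : Set F) (B : Fin n → Set E), MeasurableSet T → (∀ i, MeasurableSet (B i)) →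
      μ (W ⁻¹' T ∩ Z ⁻¹' Set.univ.pi B) = ∫⁻ s in T, ∏ i, κ s (B i) ∂(μ.map W)) :
    μ.map (fun ω => (W ω, Z ω)) = μ.map W ⊗ₘ powKernel κ n := by
  have hWZ : Measurable fun ω => (W ω, Z ω) := hW.prodMk hZ
  have : IsProbabilityMeasure (μ.map W) := Measure.isProbabilityMeasure_map hW.aemeasurable
  refine Measure.ext_prod fun {T D} hT hD => ?_
  rw [Measure.map_apply hWZ (hT.prod hD), Measure.compProd_apply_prod hT hD]
  have e1 : ∀ D : Set (Fin n → E), MeasurableSet D →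
      μ ((fun ω => (W ω, Z ω)) ⁻¹' T ×ˢ D) = (μ.restrict (W ⁻¹' T)).map Z D := by
    intro D hD
    rw [Measure.map_apply hZ hD, Measure.restrict_apply (hZ hD), Set.inter_comm]
    rfl
  have e2 : ∀ D : Set (Fin n → E), MeasurableSet D →
      ∫⁻ s in T, powKernel κ n s D ∂(μ.map W) = ((μ.map W).restrict T).bind (powKernel κ n) D :=
    fun D hD => (Measure.bind_apply hD (powKernel κ n).measurable.aemeasurable).symm
  rw [e1 D hD, e2 D hD]
  congr 1
  refine ext_of_generate_finite _ generateFrom_pi.symm isPiSystem_pi ?_ ?_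
  · rintro _ ⟨B, hB, rfl⟩
    have hB' : ∀ i, MeasurableSet (B i) := fun i => hB i (Set.mem_univ i)
    rw [← e1 _ (.univ_pi hB'), ← e2 _ (.univ_pi hB')]
    simp only [powKernel_apply, Measure.pi_pi]
    exact h T B hT hB'
  · rw [← e1 _ .univ, ← e2 _ .univ]
    simp [Measure.map_apply hW hT, Set.prod_univ, Set.preimage_preimage]

variable [StandardBorelSpace E]

/-! ### De Finetti's theorem for sequences -/

section Sequence

variable {ρ : Measure (ℕ → E)}

/-- The joint law of the tail and the head of a random sequence. -/
noncomputable def tailHeadLaw (ρ : Measure (ℕ → E)) : Measure ((ℕ → E) × E) :=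
  ρ.map fun z => (fun j => z (j + 1), z 0)

instance [IsProbabilityMeasure ρ] : IsProbabilityMeasure (tailHeadLaw ρ) :=
  Measure.isProbabilityMeasure_map (by fun_prop)

/-- By invariance, any injective list of coordinates has the same joint law of tail and head, so one
kernel disintegrates them all. -/
theorem setLIntegral_tail [IsProbabilityMeasure ρ] [Nonempty E]
    (hρ : ∀ σ : ℕ → ℕ, Function.Injective σ → ρ.map (fun z j => z (σ j)) = ρ)
    {τ : ℕ → ℕ} (hτ : Function.Injective τ) {B : Set E} (hB : MeasurableSet B)
    {f : (ℕ → E) → ℝ≥0∞} (hf : Measurable f) :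
    ∫⁻ z in (fun z => z (τ 0)) ⁻¹' B, f (fun j => z (τ (j + 1))) ∂ρ =
      ∫⁻ z, f (fun j => z (τ (j + 1))) *
        (tailHeadLaw ρ).condKernel (fun j => z (τ (j + 1))) B ∂ρ := by
  have hκ : Measurable fun w => (tailHeadLaw ρ).condKernel w B := Kernel.measurable_coe _ hB
  have hlaw : ρ.map (fun z => (fun j => z (τ (j + 1)), z (τ 0))) = tailHeadLaw ρ := by
    conv_rhs => rw [tailHeadLaw, ← hρ τ hτ]
    rw [Measure.map_map (by fun_prop) (by fun_prop)]
    rfl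
  have hfst : ρ.map (fun z j => z (τ (j + 1))) = (tailHeadLaw ρ).fst := by
    rw [← hlaw, Measure.fst_map_prodMk (by fun_prop)]
  have e1 : ∫⁻ z in (fun z => z (τ 0)) ⁻¹' B, f (fun j => z (τ (j + 1))) ∂ρ =
      ∫⁻ p in Set.univ ×ˢ B, f p.1 ∂(tailHeadLaw ρ) := by
    rw [← hlaw, setLIntegral_map (MeasurableSet.univ.prod hB) (by fun_prop) (by fun_prop)]
    congr 2
    ext z
    simp
  rw [e1, ← lintegral_map (f := fun w => f w * (tailHeadLaw ρ).condKernel w B)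
    (μ := ρ) (by fun_prop) (by fun_prop), hfst]
  conv_lhs => rw [← (tailHeadLaw ρ).disintegrate (tailHeadLaw ρ).condKernel]
  rw [Measure.setLIntegral_compProd (by fun_prop) .univ hB]
  simp

/-- The test function `f` stays general so that the induction can absorb into it the kernel factor
of the last coordinate. -/
theorem setLIntegral_even_eq [IsProbabilityMeasure ρ] [Nonempty E]
    (hρ : ∀ σ : ℕ → ℕ, Function.Injective σ → ρ.map (fun z j => z (σ j)) = ρ)
    (n : ℕ) (e : Fin n → ℕ) (he : Function.Injective e) (B : Fin n → Set E)
    (hB : ∀ i, MeasurableSet (B i)) (f : (ℕ → E) → ℝ≥0∞) (hf : Measurable f) :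
    ∫⁻ z in {z | ∀ i, z (2 * e i) ∈ B i}, f (fun j => z (2 * j + 1)) ∂ρ =
      ∫⁻ z, f (fun j => z (2 * j + 1)) *
        ∏ i, (tailHeadLaw ρ).condKernel (fun j => z (2 * j + 1)) (B i) ∂ρ := by
  induction n generalizing f with
  | zero => simp
  | succ n ih =>
    set κ := (tailHeadLaw ρ).condKernel with hκdef
    have hinj : Function.Injective fun i : Fin n => e i.castSucc :=
      he.comp (Fin.castSucc_injective n)
    -- Both lists have the last even coordinate as head. The tail of `τ` is the other `n` even
    -- coordinates, then the odd ones; the tail of `σ` is the odd ones alone.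
    let τ : ℕ → ℕ := fun j => Nat.casesOn j (2 * e (Fin.last n))
      fun j => if h : j < n then 2 * e (Fin.castSucc ⟨j, h⟩) else 2 * (j - n) + 1
    let σ : ℕ → ℕ := fun j => Nat.casesOn j (2 * e (Fin.last n)) fun j => 2 * j + 1
    have hτ_zero : τ 0 = 2 * e (Fin.last n) := rfl
    have hτ_succ : ∀ j, τ (j + 1) =
        if h : j < n then 2 * e (Fin.castSucc ⟨j, h⟩) else 2 * (j - n) + 1 := fun j => rfl
    have hσ_zero : σ 0 = 2 * e (Fin.last n) := rfl
    have hσ_succ : ∀ j, σ (j + 1) = 2 * j + 1 := fun j => rfl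
    have hτ : Function.Injective τ := by
      rintro (_ | a) (_ | b) hab
      · rfl
      · simp only [hτ_zero, hτ_succ] at hab
        split_ifs at hab with hb
        · have := he (Nat.eq_of_mul_eq_mul_left two_pos hab)
          simp [Fin.ext_iff] at this
          omega
        · omega
      · simp only [hτ_zero, hτ_succ] at hab
        split_ifs at hab with hb
        · have := he (Nat.eq_of_mul_eq_mul_left two_pos hab)
          simp [Fin.ext_iff] at this
          omega
        · omega
      · simp only [hτ_succ] at hab
        split_ifs at hab with ha hb hb
        · have := he (Nat.eq_of_mul_eq_mul_left two_pos hab)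
          simpa [Fin.ext_iff] using this
        all_goals omega
    have hσ : Function.Injective σ := by
      rintro (_ | a) (_ | b) hab <;> simp only [hσ_zero, hσ_succ] at hab <;> omega
    let g : (ℕ → E) → ℕ → E := fun w j => w (n + j)
    have hg : Measurable g := by fun_prop
    have hWg : ∀ z : ℕ → E, (fun j => z (2 * j + 1)) = g fun j => z (τ (j + 1)) := by
      intro z
      ext j
      simp [g, τ]
    have hmap : ∀ υ : ℕ → ℕ, Function.Injective υ →
        ρ.map (fun z j => z (υ (j + 1))) = ρ.map (fun z j => z (j + 1)) := by
      intro υ hυ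
      conv_rhs => rw [← hρ υ hυ, Measure.map_map (by fun_prop) (by fun_prop)]
      rfl
    have hae : ∀ᵐ z ∂ρ, κ (fun j => z (2 * j + 1)) (B (Fin.last n)) =
        κ (fun j => z (τ (j + 1))) (B (Fin.last n)) :=
      condKernel_ae_eq_of_law_eq (X := fun z : ℕ → E => z (2 * e (Fin.last n)))
        (W := fun z j => z (2 * j + 1)) (W' := fun z j => z (τ (j + 1))) (by fun_prop) hg hWg
        ((hmap σ hσ).trans (hmap τ hτ).symm) (hB _)
        (fun f hf => setLIntegral_tail hρ hσ (hB _) hf)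
        (fun f hf => setLIntegral_tail hρ hτ (hB _) hf)
    let D : Set (ℕ → E) := {w | ∀ i : Fin n, w i ∈ B i.castSucc}
    have hD : MeasurableSet D := by
      have : D = ⋂ i : Fin n, (fun w : ℕ → E => w i) ⁻¹' B i.castSucc := by
        ext; simp [D]
      rw [this]
      exact .iInter fun i => measurable_pi_apply _ (hB _)
    have hDτ : ∀ z : ℕ → E, (fun j => z (τ (j + 1))) ∈ D ↔
        ∀ i : Fin n, z (2 * e i.castSucc) ∈ B i.castSucc := by
      intro z
      simp only [D, Set.mem_ofPred_eq, hτ_succ, Fin.is_lt, dite_true, Fin.eta]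
    have hDτm : MeasurableSet {z : ℕ → E | ∀ i : Fin n, z (2 * e i.castSucc) ∈ B i.castSucc} := by
      simp_rw [← hDτ]
      exact hD.preimage (f := fun (z : ℕ → E) (j : ℕ) => z (τ (j + 1))) (by fun_prop)
    have hκm : Measurable fun w => κ w (B (Fin.last n)) := κ.measurable_coe (hB _)
    have hind : ∀ z : ℕ → E, D.indicator (fun w => f (g w)) (fun j => z (τ (j + 1))) =
        {z : ℕ → E | ∀ i : Fin n, z (2 * e i.castSucc) ∈ B i.castSucc}.indicator
          (fun z => f fun j => z (2 * j + 1)) z := by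
      intro z
      by_cases h : z ∈ {z : ℕ → E | ∀ i : Fin n, z (2 * e i.castSucc) ∈ B i.castSucc}
      · rw [Set.indicator_of_mem ((hDτ z).2 h), Set.indicator_of_mem h, hWg]
      · rw [Set.indicator_of_notMem (mt (hDτ z).1 h), Set.indicator_of_notMem h]
    -- The event on the other even coordinates depends on the tail of `τ`, so it can enter the test
    -- function.
    have hlast := setLIntegral_tail hρ hτ (hB (Fin.last n))
      (f := D.indicator fun w => f (g w)) ((hf.comp hg).indicator hD)
    simp_rw [hind] at hlast
    rw [setLIntegral_indicator hDτm] at hlast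
    have hset : {z : ℕ → E | ∀ i, z (2 * e i) ∈ B i} =
        {z : ℕ → E | ∀ i : Fin n, z (2 * e i.castSucc) ∈ B i.castSucc} ∩
          (fun z : ℕ → E => z (τ 0)) ⁻¹' B (Fin.last n) := by
      ext z
      simp [Fin.forall_fin_succ', τ]
    rw [hset, hlast]
    simp_rw [Fin.prod_univ_castSucc]
    have := ih (fun i => e i.castSucc) hinj (fun i => B i.castSucc) (fun i => hB _)
      (fun w => f w * κ w (B (Fin.last n))) (hf.mul hκm)
    rw [← lintegral_indicator hDτm] at this
    refine Eq.trans (lintegral_congr_ae ?_) (this.trans ?_)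
    · filter_upwards [hae] with z hz
      rw [← hz]
      simp only [Set.indicator]
      split_ifs <;> simp
    · refine lintegral_congr fun z => ?_
      ring

/-- **De Finetti's theorem**: the coordinates of even index of an exchangeable sequence are
independent and identically distributed conditionally on the coordinates of odd index. -/
theorem map_odd_even_eq_compProd [IsProbabilityMeasure ρ] [Nonempty E]
    (hρ : ∀ σ : ℕ → ℕ, Function.Injective σ → ρ.map (fun z j => z (σ j)) = ρ)
    {n : ℕ} {e : Fin n → ℕ} (he : Function.Injective e) :
    ρ.map (fun z => ((fun j => z (2 * j + 1) : ℕ → E), fun i => z (2 * e i))) =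
      ρ.map (fun z j => z (2 * j + 1)) ⊗ₘ powKernel (tailHeadLaw ρ).condKernel n := by
  refine map_prodMk_eq_compProd_powKernel (W := fun (z : ℕ → E) (j : ℕ) => z (2 * j + 1))
    (by fun_prop) (by fun_prop) _ fun T B hT hB => ?_
  have hTm : MeasurableSet ((fun (z : ℕ → E) (j : ℕ) => z (2 * j + 1)) ⁻¹' T) :=
    hT.preimage (by fun_prop)
  have hm : Measurable fun s => ∏ i, (tailHeadLaw ρ).condKernel s (B i) :=
    Finset.measurable_prod _ fun i _ => Kernel.measurable_coe _ (hB i)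
  have := setLIntegral_even_eq hρ n e he B hB (T.indicator 1) (measurable_one.indicator hT)
  rw [← lintegral_indicator hT, lintegral_map (hm.indicator hT) (by fun_prop)]
  refine Eq.trans ?_ (this.trans (lintegral_congr fun z => ?_))
  · change _ = ∫⁻ z in _, ((fun (z : ℕ → E) (j : ℕ) => z (2 * j + 1)) ⁻¹' T).indicator 1 z ∂ρ
    rw [lintegral_indicator_one hTm, Measure.restrict_apply hTm]
    congr 1
    ext z
    simp
  · simp only [Set.indicator]
    split_ifs <;> simp

end Sequence

end DeFinetti

/-- A finite family is exhausted by one finite sequence, which extends by assumption; an infinite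
one, once enumerated, is already an exchangeable sequence. -/
theorem Exchangeable.exists_sequence {Ω ι E : Type*} [MeasurableSpace Ω] [MeasurableSpace E]
    [Countable ι] {P : Measure Ω} [IsProbabilityMeasure P] {Y : ι → Ω → E}
    (hY : ∀ i, Measurable (Y i)) (hexch : Exchangeable P Y)
    (hext : ∀ (n : ℕ) (e : Fin n ↪ ι), ExtendsToExchangeable (jointLaw P Y e)) :
    ∃ (ρ : Measure (ℕ → E)) (φ : ι ↪ ℕ), IsProbabilityMeasure ρ ∧
      Exchangeable ρ (fun (j : ℕ) (z : ℕ → E) => z j) ∧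
      ρ.map (fun z i => z (φ i)) = P.map (fun ω i => Y i ω) := by
  rcases finite_or_infinite ι with hι | hι
  · obtain ⟨n, ⟨q⟩⟩ := Finite.exists_equiv_fin ι
    obtain ⟨ρ, hρ, hρe, hlaw⟩ := hext n q.symm.toEmbedding
    refine ⟨ρ, q.toEmbedding.trans Fin.valEmbedding, hρ, hρe, ?_⟩
    have := congrArg (Measure.map fun (x : Fin n → E) (i : ι) => x (q i)) hlaw
    rw [jointLaw, jointLaw, Measure.map_map (by fun_prop) (by fun_prop),
      Measure.map_map (by fun_prop) (by fun_prop)] at this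
    simpa [Function.comp_def] using this
  · obtain ⟨_⟩ := nonempty_denumerable ι
    let q := Denumerable.eqv ι
    have hm : Measurable fun ω (j : ℕ) => Y (q.symm j) ω := by fun_prop
    refine ⟨P.map fun ω j => Y (q.symm j) ω, q.toEmbedding,
      Measure.isProbabilityMeasure_map hm.aemeasurable, fun n e π => ?_, ?_⟩
    · have := hexch n (e.trans q.symm.toEmbedding) π
      simp only [jointLaw] at this ⊢
      rw [Measure.map_map (by fun_prop) hm, Measure.map_map (by fun_prop) hm]
      exact this
    · rw [Measure.map_map (by fun_prop) hm]
      simp [Function.comp_def]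

theorem mainTheorem3 (k : ℕ)
    {C : Type v} [MeasurableSpace C] [StandardBorelSpace C]
    {ι : Type w} [Countable ι]
    {Ω : Type u} [MeasurableSpace Ω] (P : Measure Ω) [IsProbabilityMeasure P]
    (Y : ι → Ω → Measurement k C) (hY : ∀ i, Measurable (Y i))
    (hexch : Exchangeable P Y)
    (hext : ∀ (n : ℕ) (e : Fin n ↪ ι), ExtendsToExchangeable (jointLaw P Y e)) :
    ∃ (𝕊 : Type v) (_ : MeasurableSpace 𝕊)
      (Ω' : Type (max v w)) (_ : MeasurableSpace Ω')
      (P' : Measure Ω') (Y' : ι → Ω' → Measurement k C)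
      (S : Ω' → 𝕊) (κ : Kernel 𝕊 (Measurement k C)),
      IsProbabilityMeasure P' ∧ IsMarkovKernel κ ∧
      (∀ i, Measurable (Y' i)) ∧
      P'.map (fun ω i => Y' i ω) = P.map (fun ω i => Y i ω) ∧
      IsScene P' Y' S κ ∧
      ∀ (n : ℕ) (e : Fin n ↪ ι) (B : Set (Fin n → Measurement k C)), MeasurableSet B →
        jointLaw P Y e B =
          ∫⁻ s, Measure.pi (fun _ : Fin n => κ s) B ∂(P'.map S) := by
  obtain ⟨ρ, φ, hρp, hρe, hlaw⟩ := hexch.exists_sequence hY hext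
  have hρ : ∀ σ : ℕ → ℕ, Function.Injective σ → ρ.map (fun z j => z (σ j)) = ρ :=
    fun σ hσ => hρe.map_comp_injective hσ
  have : Nonempty (Measurement k C) := (ρ.nonempty_of_neZero).map fun z => z 0
  let κ := (tailHeadLaw ρ).condKernel
  let G : (ℕ → Measurement k C) → (ℕ → Measurement k C) × (ι → Measurement k C) :=
    fun z => (fun j => z (2 * j + 1), fun i => z (2 * φ i))
  have hG : Measurable G := by fun_prop
  have hfam : (ρ.map G).map (fun p i => p.2 i) = P.map (fun ω i => Y i ω) := by
    rw [← hlaw, Measure.map_map (by fun_prop) hG]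
    -- The family sits at the places `φ i`; invariance under doubling moves it to `2 * φ i`, off the
    -- odd places.
    conv_rhs => rw [← hρ (fun j => 2 * j) (mul_right_injective₀ two_ne_zero),
      Measure.map_map (by fun_prop) (by fun_prop)]
    rfl
  have hS : (ρ.map G).map Prod.fst = ρ.map (fun z j => z (2 * j + 1)) := by
    rw [Measure.map_map measurable_fst hG]
    rfl
  have hscene : IsScene (ρ.map G) (fun i p => p.2 i) Prod.fst κ := by
    refine ⟨measurable_fst, fun n e A hA => ?_⟩
    have hdF := map_odd_even_eq_compProd hρ (φ.injective.comp e.injective)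
    have : IsProbabilityMeasure (ρ.map fun (z : ℕ → Measurement k C) j => z (2 * j + 1)) :=
      Measure.isProbabilityMeasure_map
        (Measurable.aemeasurable (by fun_prop))
    rw [hS, Measure.map_map (by fun_prop) hG]
    refine (congrArg (fun μ => μ A) hdF).trans ?_
    rw [Measure.compProd_apply hA]
    rfl
  refine ⟨ℕ → Measurement k C, inferInstance, (ℕ → Measurement k C) × (ι → Measurement k C),
    inferInstance, ρ.map G, fun i p => p.2 i, Prod.fst, κ,
    Measure.isProbabilityMeasure_map hG.aemeasurable, inferInstance, by fun_prop, hfam, hscene,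
    fun n e B hB => ?_⟩
  -- Leaving the scene coordinate free turns the conditional law into the mixture formula.
  have h1 := hscene.indep n e (Prod.snd ⁻¹' B) (measurable_snd hB)
  rw [← Measure.map_apply measurable_snd hB, Measure.map_map measurable_snd (by fun_prop)] at h1
  have h2 := congrArg (fun μ => μ.map (fun (y : ι → Measurement k C) (i : Fin n) => y (e i)) B) hfam
  rw [Measure.map_map (μ := ρ.map G) (by fun_prop) (by fun_prop),
    Measure.map_map (μ := P) (by fun_prop) (by fun_prop)] at h2
  exact h2.symm.trans h1
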